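/- Let $X$ be a metric space. For $R>0$, a family $\mathcal U$ of subsets of $X$ is called $R$-disjoint if $d(x,y)>R$ whenever $x$ and $y$ lie in two different members of $\mathcal U$; a family is called uniformly bounded if there is $M>0$ such that every member has diameter at most $M$. $X$ is said to be of countable asymptotic dimension if there is a sequence of integers $n_i\ge 1$, $i\ge 1$, such that for every sequence of positive real numbers $R_i$, $i\ge 1$, there is a sequence $\mathcal V_i$, $i\ge 1$, of families of subsets of $X$ such that (1) $\mathcal V_1=\{X\}$; (2) for every $i\ge 1$, each $U\in\mathcal V_i$ is the union of all the members of at most $n_i$ subfamilies of $\mathcal V_{i+1}$, each of which is $R_i$-disjoint; (3) at least one of the families $\mathcal V_i$ is uniformly bounded. $X$ is said to have (Yu's) Property A if for all $r>0$ and $\varepsilon>0$ there are finite sets $A_x\subset X\times\mathbb N$, $x\in X$, such that (a) $(x,1)\in A_x$ for every $x\in X$; (b) whenever $d(x,y)\le r$, the set $A_x\cap A_y$ is non-empty and $\dfrac{|A_x\setminus A_y|+|A_y\setminus A_x|}{|A_x\cap A_y|}<\varepsilon$; (c) there is $S>0$ such that $d(y,y')\le S$ whenever $(y,m),(y',m')\in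 A_z$ for some $z\in X$. **Corollary 7.7.** Every metric space of countable asymptotic dimension has Property A. -/

import Mathlib

namespace CoarseGeometry

/-- A family of subsets of a metric space is `R`-disjoint if points of different members are
at distance greater than `R`. -/
def RDisjoint {X : Type*} [MetricSpace X] (R : ℝ) (𝓤 : Set (Set X)) : Prop :=
  ∀ U ∈ 𝓤, ∀ V ∈ 𝓤, U ≠ V → ∀ x ∈ U, ∀ y ∈ V, R < dist x y

/-- A family of subsets of a metric space is uniformly bounded if some `M > 0` bounds the
diameters of all its members. -/
def UniformlyBounded {X : Type*} [MetricSpace X] (𝓤 : Set (Set X)) : Prop :=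
  ∃ M : ℝ, 0 < M ∧ ∀ U ∈ 𝓤, ∀ x ∈ U, ∀ y ∈ U, dist x y ≤ M

/-- `X` has countable asymptotic dimension. Sequences are indexed from `0` instead of `1`.
Members of the finite sequence `𝓦` may be empty families, hence "at most `n i`" families. -/
def CountableAsymptoticDimension (X : Type*) [MetricSpace X] : Prop :=
  ∃ n : ℕ → ℕ, (∀ i, 1 ≤ n i) ∧
    ∀ R : ℕ → ℝ, (∀ i, 0 < R i) →
      ∃ 𝓥 : ℕ → Set (Set X),
        𝓥 0 = {Set.univ} ∧
        (∀ i, ∀ U ∈ 𝓥 i, ∃ 𝓦 : Fin (n i) → Set (Set X),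
          (∀ j, 𝓦 j ⊆ 𝓥 (i + 1) ∧ RDisjoint (R i) (𝓦 j)) ∧ U = ⋃ j, ⋃₀ 𝓦 j) ∧
        ∃ i, UniformlyBounded (𝓥 i)

open scoped Classical in
/-- Yu's Property A. The inequality `#(A x \ A y) + #(A y \ A x) < ε * #(A x ∩ A y)` is the
usual `#(A x ∆ A y) / #(A x ∩ A y) < ε`, including the requirement that the
denominator is not zero. -/
def PropertyA (X : Type*) [MetricSpace X] : Prop :=
  ∀ r ε : ℝ, 0 < r → 0 < ε →
    ∃ A : X → Finset (X × ℕ),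
      (∀ x, (x, 1) ∈ A x) ∧
      (∀ x y, dist x y ≤ r →
        ((A x \ A y).card : ℝ) + ((A y \ A x).card : ℝ) < ε * ((A x ∩ A y).card : ℝ)) ∧
      ∃ S : ℝ, 0 < S ∧ ∀ z, ∀ p ∈ A z, ∀ q ∈ A z, dist p.1 q.1 ≤ S

end CoarseGeometry

namespace CoarseGeometry

/-! The proof builds probability measures on `X` that vary slowly with the base point, then
discretizes them. Members of the bounded family carry Dirac masses. Working back up the
decompositions, `ExactNear.of_decomposition` glues the measures of the pieces by a partition of
unity, which adds an error proportional to `n i * r` divided by the loss of thickening radius. The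
numbers `n i` are fixed before the `R i`, so the radii can be chosen to make these errors a
geometric series, and `R i` can then separate the thickened pieces, wherever the bounded family
occurs. Uniformly bounded support cardinality keeps the rounding error small in
`propertyA_of_exactNear_univ`. -/

variable {X : Type*} [MetricSpace X]

/-- On the open `t`-neighbourhood of `U` there are finitely supported probability measures
`f x`, with supports of at most `K` points in the `S`-ball about `x`, which vary by at most `ε`
in the `ℓ¹`-norm when `x` moves by at most `r`. -/
def ExactNear (r t ε S : ℝ) (K : ℕ) (U : Set X) : Prop :=
  ∃ f : X → X → ℝ, (∀ x z, 0 ≤ f x z) ∧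
    (∀ x ∈ Metric.thickening t U, ∃ T : Finset X, T.card ≤ K ∧ (∀ z ∈ T, dist x z ≤ S) ∧
      (∀ z, z ∉ T → f x z = 0) ∧ ∑ z ∈ T, f x z = 1) ∧
    ∀ x ∈ Metric.thickening t U, ∀ y ∈ Metric.thickening t U, dist x y ≤ r →
      ∀ F : Finset X, ∑ z ∈ F, |f x z - f y z| ≤ ε

/-- The Dirac mass at one fixed point of `U` serves for every `x`, so nothing varies. -/
theorem ExactNear.of_bounded {r t ε M : ℝ} (hε : 0 ≤ ε) {U : Set X}
    (hU : ∀ x ∈ U, ∀ y ∈ U, dist x y ≤ M) : ExactNear r t ε (t + M) 1 U := by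
  classical
  rcases U.eq_empty_or_nonempty with rfl | ⟨u, hu⟩
  · exact ⟨fun _ _ => 0, by simp, by simp, by simp⟩
  · refine ⟨fun _ z => if z = u then 1 else 0, fun x z => by positivity, ?_, ?_⟩
    · intro x hx
      obtain ⟨v, hv, hxv⟩ := Metric.mem_thickening_iff.1 hx
      refine ⟨{u}, by simp, ?_, ?_, by simp⟩
      · simp only [Finset.mem_singleton, forall_eq]
        linarith [dist_triangle x v u, hU v hv u hu]
      · intro z hz
        simpa using hz
    · intro x _ y _ _ F
      simpa using hε

/-! ### Partitions of unity and gluing -/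

/-- A `1`-Lipschitz bump function around an arbitrary set, possibly empty. -/
theorem exists_lipschitz_bump (s : ℝ) (B : Set X) :
    ∃ ψ : X → ℝ, (∀ x, 0 ≤ ψ x) ∧ (∀ x, 0 < ψ x → ∃ b ∈ B, dist x b < s) ∧
      (∀ x, ∀ b ∈ B, s - dist x b ≤ ψ x) ∧ ∀ x y, |ψ x - ψ y| ≤ dist x y := by
  -- `Metric.infDist` to the empty set is `0`, so the general formula would give `max s 0` there
  -- instead of `0`.
  rcases B.eq_empty_or_nonempty with rfl | hB
  · exact ⟨fun _ => 0, by simp, by simp, by simp, by simp⟩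
  · refine ⟨fun x => max (s - Metric.infDist x B) 0, fun x => le_max_right _ _, ?_, ?_, ?_⟩
    · intro x hx
      rcases lt_max_iff.1 hx with h | h
      · exact (Metric.infDist_lt_iff hB).1 (by linarith)
      · exact absurd h (lt_irrefl _)
    · intro x b hb
      exact le_max_of_le_left (by linarith [Metric.infDist_le_dist_of_mem (x := x) hb])
    · intro x y
      refine (abs_max_sub_max_le_abs _ _ _).trans ?_
      rw [abs_le]
      have h1 := Metric.infDist_le_infDist_add_dist (s := B) (x := x) (y := y)
      have h2 := Metric.infDist_le_infDist_add_dist (s := B) (x := y) (y := x)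
      rw [dist_comm y x] at h2
      constructor <;> linarith

/-- Normalizing nonnegative vectors of mass at least `δ` is Lipschitz in the `ℓ¹`-norm. -/
theorem sum_abs_div_sub_div_le {ι : Type*} [Fintype ι] {a b : ι → ℝ} {δ r : ℝ} (hδ : 0 < δ)
    (hb : ∀ j, 0 ≤ b j) (hA : δ ≤ ∑ j, a j) (hB : δ ≤ ∑ j, b j) (hr : ∀ j, |a j - b j| ≤ r) :
    ∑ j, |a j / ∑ k, a k - b j / ∑ k, b k| ≤ 2 * Fintype.card ι * r / δ := by
  set A := ∑ k, a k with hAdef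
  set B := ∑ k, b k with hBdef
  have hA0 : 0 < A := hδ.trans_le hA
  have hB0 : 0 < B := hδ.trans_le hB
  have hsum : ∑ j, |a j - b j| ≤ Fintype.card ι * r := by
    simpa using Finset.sum_le_sum fun j (_ : j ∈ Finset.univ) => hr j
  have hAB : |B - A| ≤ ∑ j, |a j - b j| := by
    rw [abs_sub_comm, hAdef, hBdef, ← Finset.sum_sub_distrib]
    exact Finset.abs_sum_le_sum_abs _ _
  -- After summation over `j` each of the two terms is at most `(∑ j, |a j - b j|) / A`; hence the
  -- factor `2`.
  have hterm : ∀ j, |a j / A - b j / B| ≤ |a j - b j| / A + b j * (|B - A| / (A * B)) := by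
    intro j
    have : a j / A - b j / B = (a j - b j) / A + b j * ((B - A) / (A * B)) := by
      field_simp
      ring
    rw [this]
    refine (abs_add_le _ _).trans (le_of_eq ?_)
    rw [abs_div, abs_mul, abs_div, abs_of_pos hA0, abs_of_pos (mul_pos hA0 hB0),
      abs_of_nonneg (hb j)]
  calc ∑ j, |a j / A - b j / B|
      ≤ ∑ j, (|a j - b j| / A + b j * (|B - A| / (A * B))) :=
        Finset.sum_le_sum fun j _ => hterm j
    _ = (∑ j, |a j - b j| + |B - A|) / A := by
        rw [Finset.sum_add_distrib, ← Finset.sum_div, ← Finset.sum_mul, ← hBdef]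
        field_simp
    _ ≤ (2 * Fintype.card ι * r) / A := by
        gcongr
        linarith
    _ ≤ 2 * Fintype.card ι * r / δ := by
        have : 0 ≤ 2 * Fintype.card ι * r := by
          have := (Finset.sum_nonneg fun j (_ : j ∈ Finset.univ) => abs_nonneg (a j - b j)).trans
            hsum
          linarith
        gcongr

/-- One bump function per colour `j`, of width `s`, has total mass at least `s - t` near `U`. The
normalized bumps therefore vary by at most `2 * n * r / (s - t)`, and averaging the measures of the
pieces with these weights adds only `ε`. -/
theorem ExactNear.of_decomposition {r t s ε S R : ℝ} {K n : ℕ} (hts : t < s) (hε : 0 ≤ ε)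
    (hR : 2 * s + r ≤ R) {U : Set X} {W : Fin n → Set (Set X)}
    (hdisj : ∀ j, RDisjoint R (W j)) (hU : U = ⋃ j, ⋃₀ W j)
    (hW : ∀ j, ∀ V ∈ W j, ExactNear r s ε S K V) :
    ExactNear r t (2 * n * r / (s - t) + ε) S (n * K) U := by
  classical
  choose ψ hψ0 hψpos hψge hψlip using fun j => exists_lipschitz_bump (X := X) s (⋃₀ W j)
  have hnear : ∀ j x, ∃ V, 0 < ψ j x → V ∈ W j ∧ x ∈ Metric.thickening s V := by
    intro j x
    by_cases h : 0 < ψ j x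
    · obtain ⟨b, ⟨V, hV, hbV⟩, hxb⟩ := hψpos j x h
      exact ⟨V, fun _ => ⟨hV, Metric.mem_thickening_iff.2 ⟨b, hbV, hxb⟩⟩⟩
    · exact ⟨∅, fun h' => absurd h' h⟩
  choose V hV using hnear
  -- Otherwise two members of `W j` would contain points at distance less than `2 * s + r ≤ R`.
  have hVeq : ∀ j x y, dist x y ≤ r → 0 < ψ j x → 0 < ψ j y → V j x = V j y := by
    intro j x y hxy hx hy
    by_contra hne
    obtain ⟨v, hv, hxv⟩ := Metric.mem_thickening_iff.1 (hV j x hx).2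
    obtain ⟨w, hw, hyw⟩ := Metric.mem_thickening_iff.1 (hV j y hy).2
    have := hdisj j _ (hV j x hx).1 _ (hV j y hy).1 hne v hv w hw
    have h1 := dist_triangle4 v x y w
    rw [dist_comm v x] at h1
    linarith
  have hmass : ∀ x ∈ Metric.thickening t U, s - t ≤ ∑ j, ψ j x := by
    intro x hx
    obtain ⟨u, hu, hxu⟩ := Metric.mem_thickening_iff.1 hx
    rw [hU] at hu
    obtain ⟨j, hj⟩ := Set.mem_iUnion.1 hu
    have h1 := hψge j x u hj
    have h2 := Finset.single_le_sum (f := fun j => ψ j x) (fun j _ => hψ0 j x) (Finset.mem_univ j)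
    linarith
  -- The family `g` is chosen per set `V`, not per point, so that nearby points with the same `V`
  -- use the same family.
  have hg : ∀ V : Set X, ∃ g : X → X → ℝ, (∀ x z, 0 ≤ g x z) ∧ (ExactNear r s ε S K V →
      (∀ x ∈ Metric.thickening s V, ∃ T : Finset X, T.card ≤ K ∧ (∀ z ∈ T, dist x z ≤ S) ∧
        (∀ z, z ∉ T → g x z = 0) ∧ ∑ z ∈ T, g x z = 1) ∧
      ∀ x ∈ Metric.thickening s V, ∀ y ∈ Metric.thickening s V, dist x y ≤ r →
        ∀ F : Finset X, ∑ z ∈ F, |g x z - g y z| ≤ ε) := by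
    intro V
    by_cases h : ExactNear r s ε S K V
    · obtain ⟨g, h0, h1⟩ := h
      exact ⟨g, h0, fun _ => h1⟩
    · exact ⟨fun _ _ => 0, by simp, fun h' => absurd h' h⟩
  choose g hg0 hg using hg
  have hgT : ∀ j x, ∃ T : Finset X, 0 < ψ j x → T.card ≤ K ∧ (∀ z ∈ T, dist x z ≤ S) ∧
      (∀ z, z ∉ T → g (V j x) x z = 0) ∧ ∑ z ∈ T, g (V j x) x z = 1 := by
    intro j x
    by_cases h : 0 < ψ j x
    · obtain ⟨T, hT⟩ := (hg _ (hW j _ (hV j x h).1)).1 x (hV j x h).2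
      exact ⟨T, fun _ => hT⟩
    · exact ⟨∅, fun h' => absurd h' h⟩
  choose T hT using hgT
  have hsumle : ∀ j x, 0 < ψ j x → ∀ F : Finset X, ∑ z ∈ F, g (V j x) x z ≤ 1 := by
    intro j x h F
    obtain ⟨-, -, hz, h1⟩ := hT j x h
    rw [← h1]
    rw [Finset.sum_subset (Finset.subset_union_right (s₁ := F)) fun z _ hn => hz z hn]
    exact Finset.sum_le_sum_of_subset_of_nonneg Finset.subset_union_left fun z _ _ => hg0 _ _ _
  let c : Fin n → X → ℝ := fun j x => ψ j x / ∑ k, ψ k x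
  have hc0 : ∀ j x, 0 ≤ c j x := fun j x =>
    div_nonneg (hψ0 j x) (Finset.sum_nonneg fun k _ => hψ0 k x)
  have hcpos : ∀ j x, c j x ≠ 0 → 0 < ψ j x := fun j x h =>
    (hψ0 j x).lt_of_ne' fun h0 => h (by simp [c, h0])
  have hc1 : ∀ x ∈ Metric.thickening t U, ∑ j, c j x = 1 := by
    intro x hx
    have := hmass x hx
    rw [← Finset.sum_div, div_self]
    linarith
  refine ⟨fun x z => ∑ j, c j x * g (V j x) x z, fun x z =>
    Finset.sum_nonneg fun j _ => mul_nonneg (hc0 j x) (hg0 _ _ _), ?_, ?_⟩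
  · intro x hx
    refine ⟨(Finset.univ.filter fun j => 0 < ψ j x).biUnion fun j => T j x, ?_, ?_, ?_, ?_⟩
    · refine (Finset.card_biUnion_le_card_mul _ _ K fun j hj => ?_).trans ?_
      · exact (hT j x (Finset.mem_filter.1 hj).2).1
      · gcongr
        exact (Finset.card_filter_le _ _).trans (by simp)
    · intro z hz
      obtain ⟨j, hj, hzj⟩ := Finset.mem_biUnion.1 hz
      exact (hT j x (Finset.mem_filter.1 hj).2).2.1 z hzj
    · intro z hz
      refine Finset.sum_eq_zero fun j _ => ?_
      by_cases h : c j x = 0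
      · simp [h]
      · rw [(hT j x (hcpos j x h)).2.2.1 z fun hzj => hz (Finset.mem_biUnion.2
          ⟨j, Finset.mem_filter.2 ⟨Finset.mem_univ _, hcpos j x h⟩, hzj⟩), mul_zero]
    · rw [Finset.sum_comm, ← hc1 x hx]
      refine Finset.sum_congr rfl fun j _ => ?_
      rw [← Finset.mul_sum]
      by_cases h : c j x = 0
      · simp [h]
      · have hp := hcpos j x h
        obtain ⟨-, -, hz, h1⟩ := hT j x hp
        rw [← Finset.sum_subset (Finset.subset_biUnion_of_mem (fun j => T j x)
          (Finset.mem_filter.2 ⟨Finset.mem_univ j, hp⟩)) fun z _ hn => hz z hn, h1, mul_one]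
  · intro x hx y hy hxy F
    -- Where a weight vanishes, `V j` is arbitrary and the two measures cannot be compared; the
    -- change of weight alone bounds the sum.
    have hterm : ∀ j, ∑ z ∈ F, |c j x * g (V j x) x z - c j y * g (V j y) y z| ≤
        |c j x - c j y| + c j x * ε := by
      intro j
      by_cases h : c j x = 0
      · by_cases h' : c j y = 0
        · simp [h, h']
        · have := hsumle j y (hcpos j y h') F
          simp only [h, zero_mul, zero_sub, abs_neg, add_zero]
          rw [abs_of_nonneg (hc0 j y)]
          calc _ = c j y * ∑ z ∈ F, g (V j y) y z := by
                rw [Finset.mul_sum]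
                exact Finset.sum_congr rfl fun z _ =>
                  abs_of_nonneg (mul_nonneg (hc0 _ _) (hg0 _ _ _))
            _ ≤ c j y := mul_le_of_le_one_right (hc0 _ _) this
      · have hx' := hcpos j x h
        have hsx := hsumle j x hx' F
        by_cases h' : c j y = 0
        · simp only [h', zero_mul, sub_zero]
          rw [abs_of_nonneg (hc0 j x)]
          calc _ = c j x * ∑ z ∈ F, g (V j x) x z := by
                rw [Finset.mul_sum]
                exact Finset.sum_congr rfl fun z _ =>
                  abs_of_nonneg (mul_nonneg (hc0 _ _) (hg0 _ _ _))
            _ ≤ c j x := mul_le_of_le_one_right (hc0 _ _) hsx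
            _ ≤ _ := le_add_of_nonneg_right (mul_nonneg (hc0 _ _) hε)
        · have hy' := hcpos j y h'
          have hsy := hsumle j y hy' F
          have hVy := hV j y hy'
          rw [← hVeq j x y hxy hx' hy'] at hsy hVy ⊢
          have hd := (hg _ (hW j _ (hV j x hx').1)).2 x (hV j x hx').2 y hVy.2 hxy F
          calc _ ≤ ∑ z ∈ F, (|c j x - c j y| * g (V j x) y z +
                  c j x * |g (V j x) x z - g (V j x) y z|) := by
                refine Finset.sum_le_sum fun z _ => ?_
                have : c j x * g (V j x) x z - c j y * g (V j x) y z =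
                    (c j x - c j y) * g (V j x) y z +
                      c j x * (g (V j x) x z - g (V j x) y z) := by ring
                rw [this]
                refine (abs_add_le _ _).trans (le_of_eq ?_)
                rw [abs_mul, abs_mul, abs_of_nonneg (hg0 _ _ _), abs_of_nonneg (hc0 j x)]
            _ ≤ _ := by
                rw [Finset.sum_add_distrib, ← Finset.mul_sum, ← Finset.mul_sum]
                exact add_le_add (mul_le_of_le_one_right (abs_nonneg _) hsy)
                  (mul_le_mul_of_nonneg_left hd (hc0 _ _))
    calc ∑ z ∈ F, |∑ j, c j x * g (V j x) x z - ∑ j, c j y * g (V j y) y z|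
        ≤ ∑ z ∈ F, ∑ j, |c j x * g (V j x) x z - c j y * g (V j y) y z| := by
          refine Finset.sum_le_sum fun z _ => ?_
          rw [← Finset.sum_sub_distrib]
          exact Finset.abs_sum_le_sum_abs _ _
      _ = ∑ j, ∑ z ∈ F, |c j x * g (V j x) x z - c j y * g (V j y) y z| := Finset.sum_comm
      _ ≤ ∑ j, (|c j x - c j y| + c j x * ε) := Finset.sum_le_sum fun j _ => hterm j
      _ = ∑ j, |c j x - c j y| + ε := by
          rw [Finset.sum_add_distrib, ← Finset.sum_mul, hc1 x hx, one_mul]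
      _ ≤ 2 * n * r / (s - t) + ε := by
          have := sum_abs_div_sub_div_le (a := fun j => ψ j x) (b := fun j => ψ j y)
            (sub_pos.2 hts) (fun j => hψ0 j y) (hmass x hx) (hmass y hy)
            fun j => (hψlip j x y).trans hxy
          rw [Fintype.card_fin] at this
          gcongr

/-! ### Induction from the bounded family back to the whole space -/

theorem CountableAsymptoticDimension.exactNear_univ (hX : CountableAsymptoticDimension X)
    {r ε : ℝ} (hr : 0 < r) (hε : 0 < ε) :
    ∃ (S : ℝ) (K : ℕ), ExactNear r 1 ε S K (Set.univ : Set X) := by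
  obtain ⟨n, hn, hX⟩ := hX
  -- The increment makes the gluing error at level `i` exactly `ε / 2 ^ (i + 1)`, so errors `ε / 2 ^
  -- (i + 1)` below become `ε / 2 ^ i` above.
  let t : ℕ → ℝ := fun i => 1 + ∑ k ∈ Finset.range i, 2 * n k * r / (ε * (1 / 2) ^ (k + 1))
  have hn' : ∀ i, (0 : ℝ) < n i := fun i => by exact_mod_cast hn i
  have hinc : ∀ i, t (i + 1) - t i = 2 * n i * r / (ε * (1 / 2) ^ (i + 1)) := by
    intro i
    simp only [t, Finset.sum_range_succ]
    ring
  have hpos : ∀ i, 0 < 2 * n i * r / (ε * (1 / 2) ^ (i + 1)) := by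
    intro i
    have := hn' i
    positivity
  have ht : ∀ i, 0 < t i := fun i =>
    add_pos_of_pos_of_nonneg one_pos (Finset.sum_nonneg fun k _ => (hpos k).le)
  obtain ⟨𝓥, h0, hdec, m, M, -, hM⟩ := hX (fun i => 2 * t (i + 1) + r) fun i => by
    have := ht (i + 1)
    positivity
  have key : ∀ k i, i + k = m →
      ∃ (S : ℝ) (K : ℕ), ∀ U ∈ 𝓥 i, ExactNear r (t i) (ε * (1 / 2) ^ i) S K U := by
    intro k
    induction k with
    | zero =>
      rintro i rfl
      exact ⟨_, 1, fun U hU => ExactNear.of_bounded (by positivity) (hM U hU)⟩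
    | succ k ih =>
      intro i hi
      obtain ⟨S, K, hSK⟩ := ih (i + 1) (by omega)
      refine ⟨S, n i * K, fun U hU => ?_⟩
      obtain ⟨W, hW, hUW⟩ := hdec i U hU
      have := ExactNear.of_decomposition (t := t i) (sub_pos.1 ((hinc i).symm ▸ hpos i))
        (by positivity) le_rfl (fun j => (hW j).2) hUW fun j V hV => hSK V ((hW j).1 hV)
      convert this using 1
      rw [hinc i, div_div_cancel₀ (by have := hn' i; positivity)]
      ring
  obtain ⟨S, K, h⟩ := key m 0 (zero_add m)
  refine ⟨S, K, ?_⟩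
  simpa [t] using h Set.univ (by simp [h0])

/-! ### From measures to finite sets -/

/-- The region under the graph of `h` over `T`, together with the point `(x, 1)`. -/
def subgraphWithPoint {Y : Type*} [DecidableEq Y] (x : Y) (T : Finset Y) (h : Y → ℕ) : Finset (Y × ℕ) :=
  insert (x, 1) ((T.sigma fun z => Finset.range (h z)).map
    (Equiv.sigmaEquivProd Y ℕ).toEmbedding)

theorem mem_subgraphWithPoint {Y : Type*} [DecidableEq Y] {x : Y} {T : Finset Y} {h : Y → ℕ} {p : Y × ℕ} :
    p ∈ subgraphWithPoint x T h ↔ p = (x, 1) ∨ p.1 ∈ T ∧ p.2 < h p.1 := by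
  obtain ⟨a, b⟩ := p
  simp only [subgraphWithPoint, Finset.mem_insert, Finset.mem_map_equiv]
  simp [Equiv.sigmaEquivProd]

theorem sum_le_card_subgraphWithPoint {Y : Type*} [DecidableEq Y] (x : Y) (T : Finset Y) (h : Y → ℕ) :
    ∑ z ∈ T, h z ≤ (subgraphWithPoint x T h).card := by
  refine le_trans (le_of_eq ?_) (Finset.card_le_card (Finset.subset_insert _ _))
  simp

/-- Truncated subtraction counts the part of each column of `h` above `h'`; the extra `1` pays for
the point `(x, 1)`. -/
theorem card_subgraphWithPoint_sdiff_le {Y : Type*} [DecidableEq Y] {x y : Y}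
    {T T' : Finset Y} {h h' : Y → ℕ} (hT' : ∀ z, z ∉ T' → h' z = 0) :
    (subgraphWithPoint x T h \ subgraphWithPoint y T' h').card ≤ ∑ z ∈ T, (h z - h' z) + 1 := by
  have hsub : subgraphWithPoint x T h \ subgraphWithPoint y T' h' ⊆
      insert (x, 1) ((T.sigma fun z => Finset.Ico (h' z) (h z)).map
        (Equiv.sigmaEquivProd Y ℕ).toEmbedding) := by
    rintro ⟨a, b⟩ hp
    simp only [Finset.mem_sdiff, mem_subgraphWithPoint, not_or, not_and, not_lt] at hp
    obtain ⟨hp | ⟨ha, hb⟩, -, hp'⟩ := hp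
    · exact Finset.mem_insert.2 (Or.inl hp)
    · refine Finset.mem_insert_of_mem (Finset.mem_map_equiv.2 ?_)
      have : h' a ≤ b := by
        by_cases haT : a ∈ T'
        · exact hp' haT
        · simp [hT' a haT]
      simp [Equiv.sigmaEquivProd, ha, hb, this]
  refine (Finset.card_le_card hsub).trans ((Finset.card_insert_le _ _).trans ?_)
  simp

theorem propertyA_of_exactNear_univ
    (hX : ∀ r ε : ℝ, 0 < r → 0 < ε →
      ∃ (S : ℝ) (K : ℕ), ExactNear r 1 ε S K (Set.univ : Set X)) : PropertyA X := by
  classical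
  intro r ε hr hε
  set δ := min ε 1 with hδ
  have hδ0 : 0 < δ := lt_min hε one_pos
  have hδ1 : δ ≤ 1 := min_le_right _ _
  have hδε : δ ≤ ε := min_le_left _ _
  obtain ⟨S, K, f, hf0, hfT, hfd⟩ := hX r (δ / 4) hr (by positivity)
  have hmem : ∀ x : X, x ∈ Metric.thickening 1 (Set.univ : Set X) := fun x =>
    Metric.self_subset_thickening one_pos _ (Set.mem_univ x)
  choose T hTK hTS hT0 hT1 using fun x => hfT x (hmem x)
  -- The symmetric difference has at most `N * δ / 4 + 2 * K + 2` points and `A x` at least `N - K`.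
  -- As `δ ≤ 1`, the final inequality follows from `N * δ / 2 > 5 * K + 4`.
  obtain ⟨N, hN⟩ := exists_nat_gt ((2 * (2 * K + 2) + K) / (δ / 2) : ℝ)
  rw [div_lt_iff₀ (by positivity)] at hN
  let h : X → X → ℕ := fun x z => ⌊N * f x z⌋₊
  have hh0 : ∀ x z, z ∉ T x → h x z = 0 := fun x z hz => by simp [h, hT0 x z hz]
  have hfl : ∀ x z, (h x z : ℝ) ≤ N * f x z := fun x z =>
    Nat.floor_le (mul_nonneg (Nat.cast_nonneg _) (hf0 x z))
  have hfl' : ∀ x z, N * f x z < h x z + 1 := fun x z => Nat.lt_floor_add_one _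
  have hcardT : ∀ x, ((T x).card : ℝ) ≤ K := fun x => by exact_mod_cast hTK x
  -- The sign of `S` is unknown, hence `|S|`; the `1` only ensures positivity.
  refine ⟨fun x => subgraphWithPoint x (T x) (h x),
    fun x => mem_subgraphWithPoint.2 (Or.inl rfl), ?_, 2 * |S| + 1, by positivity, ?_⟩
  · intro x y hxy
    have hsd : ∀ x y, ((subgraphWithPoint x (T x) (h x) \
        subgraphWithPoint y (T y) (h y)).card : ℝ) ≤ ∑ z ∈ T x, ((h x z - h y z : ℕ) : ℝ) + 1 := by
      intro x y
      exact_mod_cast card_subgraphWithPoint_sdiff_le (x := x) (y := y) (hh0 y)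
    have hsum : ∑ z ∈ T x, ((h x z - h y z : ℕ) : ℝ) + ∑ z ∈ T y, ((h y z - h x z : ℕ) : ℝ) ≤
        N * (δ / 4) + 2 * K := by
      calc _ ≤ ∑ z ∈ T x ∪ T y, ((h x z - h y z : ℕ) : ℝ) +
            ∑ z ∈ T x ∪ T y, ((h y z - h x z : ℕ) : ℝ) := by
            gcongr
            · exact Finset.subset_union_left
            · exact Finset.subset_union_right
        _ = ∑ z ∈ T x ∪ T y, (((h x z - h y z : ℕ) : ℝ) + ((h y z - h x z : ℕ) : ℝ)) :=
            Finset.sum_add_distrib.symm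
        _ ≤ ∑ z ∈ T x ∪ T y, (N * |f x z - f y z| + 1) := by
            refine Finset.sum_le_sum fun z _ => ?_
            have hNn : (0 : ℝ) ≤ N := Nat.cast_nonneg _
            have h1 := mul_le_mul_of_nonneg_left (le_abs_self (f x z - f y z)) hNn
            have h2 := mul_le_mul_of_nonneg_left (neg_abs_le (f x z - f y z)) hNn
            have h3 := hfl x z
            have h4 := hfl y z
            have h5 := hfl' x z
            have h6 := hfl' y z
            rcases le_total (h x z) (h y z) with hle | hle
            · rw [Nat.sub_eq_zero_of_le hle, Nat.cast_sub hle, Nat.cast_zero]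
              linarith
            · rw [Nat.sub_eq_zero_of_le hle, Nat.cast_sub hle, Nat.cast_zero]
              linarith
        _ = N * ∑ z ∈ T x ∪ T y, |f x z - f y z| + (T x ∪ T y).card := by
            rw [Finset.sum_add_distrib, ← Finset.mul_sum]
            simp
        _ ≤ N * (δ / 4) + 2 * K := by
            have hc : ((T x ∪ T y).card : ℝ) ≤ (T x).card + (T y).card := by
              exact_mod_cast Finset.card_union_le _ _
            have := hfd x (hmem x) y (hmem y) hxy (T x ∪ T y)
            gcongr
            linarith [hcardT x, hcardT y]
    have hcard : (N : ℝ) - K ≤ (subgraphWithPoint x (T x) (h x)).card := by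
      have h1 : ((∑ z ∈ T x, h x z : ℕ) : ℝ) ≤ (subgraphWithPoint x (T x) (h x)).card := by
        exact_mod_cast sum_le_card_subgraphWithPoint x (T x) (h x)
      refine le_trans ?_ h1
      push_cast
      have h2 : ∑ z ∈ T x, N * f x z ≤ ∑ z ∈ T x, ((h x z : ℝ) + 1) :=
        Finset.sum_le_sum fun z _ => (hfl' x z).le
      rw [← Finset.mul_sum, hT1, Finset.sum_add_distrib] at h2
      simp only [Finset.sum_const, nsmul_eq_mul, mul_one] at h2
      linarith [hcardT x]
    have hinter : ((subgraphWithPoint x (T x) (h x) \ subgraphWithPoint y (T y) (h y)).card : ℝ) +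
        (subgraphWithPoint x (T x) (h x) ∩ subgraphWithPoint y (T y) (h y)).card =
          (subgraphWithPoint x (T x) (h x)).card := by
      exact_mod_cast Finset.card_sdiff_add_card_inter _ _
    have h1 := hsd x y
    have h2 := hsd y x
    have h3 : (0 : ℝ) ≤ (subgraphWithPoint y (T y) (h y) \
      subgraphWithPoint x (T x) (h x)).card := Nat.cast_nonneg _
    set a : ℝ := ((subgraphWithPoint x (T x) (h x) \ subgraphWithPoint y (T y) (h y)).card : ℝ)
    set b : ℝ := ((subgraphWithPoint y (T y) (h y) \ subgraphWithPoint x (T x) (h x)).card : ℝ)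
    set c : ℝ := ((subgraphWithPoint x (T x) (h x) ∩ subgraphWithPoint y (T y) (h y)).card : ℝ)
    have hc0 : 0 ≤ c := Nat.cast_nonneg _
    have hc : N - K - (N * (δ / 4) + 2 * K + 2) ≤ c := by linarith
    have hNn : (0 : ℝ) ≤ N := Nat.cast_nonneg _
    have hKn : (0 : ℝ) ≤ K := Nat.cast_nonneg _
    calc a + b ≤ N * (δ / 4) + 2 * K + 2 := by linarith
      _ < δ * (N - K - (N * (δ / 4) + 2 * K + 2)) := by
          nlinarith [mul_le_mul_of_nonneg_left hδ1 (mul_nonneg hNn hδ0.le),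
            mul_le_mul_of_nonneg_right hδ1 hKn]
      _ ≤ δ * c := by gcongr
      _ ≤ ε * c := by gcongr
  · intro z p hp q hq
    have hball : ∀ p ∈ subgraphWithPoint z (T z) (h z), dist z p.1 ≤ |S| := by
      intro p hp
      rcases mem_subgraphWithPoint.1 hp with rfl | ⟨hp, -⟩
      · simp
      · exact (hTS z _ hp).trans (le_abs_self S)
    have := dist_triangle_left p.1 q.1 z
    linarith [hball p hp, hball q hq]

end CoarseGeometry

theorem corollary7p7 {X : Type*} [MetricSpace X]
    (hX : CoarseGeometry.CountableAsymptoticDimension X) :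
    CoarseGeometry.PropertyA X :=
  CoarseGeometry.propertyA_of_exactNear_univ fun _ _ hr hε => hX.exactNear_univ hr hε
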